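/- Let $S^1=\mathbb R/\mathbb Z$, let $T^3=\mathbb R^3/\mathbb Z^3$ carry the flat metric $h_{\rm flat}=\sum_{i=1}^3 (dx^i)^2$, and let $M=S^1\times T^3$ with coordinates $(t,x^1,x^2,x^3)$. Let $\alpha,\gamma_1,\gamma_2>0$ and $\beta\in\mathbb R$. For a Riemannian metric $g$ and a $3$-form $T$ on $M$, the *equations of motion* are $$0=3\gamma_1\,T-\gamma_2\,d\delta T,$$ $$0=\alpha\,G^g-\beta\,B^g+\gamma_1\Bigl(-6\,g^{*T}+\tfrac12\|T\|^2 g\Bigr)-\gamma_2\Bigl(-2\,g^{d*T}+\tfrac12\|\delta T\|^2 g\Bigr).$$ Here $*$ is the Hodge operator of $g$ (for the orientation $dt\wedge dx^1\wedge dx^2\wedge dx^3$), $\delta=-{*}d{*}$ is the codifferential, $G^g=\mathrm{ric}^g-\frac12R^g g$ is the Einstein tensor, and $B^g$ is the Bach tensor, $B_{ij}=\nabla^k\nabla^l C_{kijl}+\frac12\mathrm{ric}^{kl}C_{kijl}$, where $C$ is the Weyl tensor and the curvature convention is $R_{ijkl}=\langle \mathrm{Riem}(\partial_i,\partial_j)\partial_k,\partial_l\rangle$,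 $\mathrm{Riem}(X,Y)Z=\nabla_X\nabla_YZ-\nabla_Y\nabla_XZ-\nabla_{[X,Y]}Z$, $\mathrm{ric}(X,Y)=\mathrm{tr}(V\mapsto \mathrm{Riem}(V,X)Y)$. For a $k$-form $\eta$, $\|\eta\|^2=\sum_{i_1,\dots,i_k}\eta(E_{i_1},\dots,E_{i_k})^2$ over all indices of an orthonormal basis $(E_i)$, and $g^\eta(X,Y)=\langle X\lrcorner\eta,\,Y\lrcorner\eta\rangle_g$, where $\langle\cdot,\cdot\rangle_g$ is the scalar product of forms for which the $E^*_{i_1}\wedge\dots\wedge E^*_{i_m}$, $i_1<\dots<i_m$, are orthonormal. Let $f:S^1\to(0,\infty)$ and $\tau:S^1\to\mathbb R$ be smooth, and put $$g=dt^2+f(t)^2\,h_{\rm flat},\qquad T=\tau(t)\,\bigl(dx^1\wedge dx^2+dx^2\wedge dx^3+dx^3\wedge dx^1\bigr)\wedge dt .$$ 1. At every point of $M$, the $dt$-$dt$ component of the right-hand side of the second equation of motion equals $$3\alpha\Bigl(\frac{\dot f}{f}\Bigr)^2+9\gamma_1\Bigl(\frac{\tau}{f^2}\Bigr)^2+3\gamma_2\Bigl(\frac{f\dot\tau-\tau\dot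 f}{f^3}\Bigr)^2,$$ a sum of nonnegative terms. 2. If $(M,g,T)$ solves the equations of motion, then $\tau=0$ everywhere, and hence $T=0$. -/

import Mathlib

noncomputable section

namespace TorsionTorus

/-! ## The manifold `S¹ × T³`, differentiation and differential forms on it

The circle is `ℝ / ℤ`.  The coordinate `t` has number `0`, the coordinates `x¹, x², x³` have
numbers `1, 2, 3`.  The coordinate fields `∂₀, …, ∂₃` form a global frame of the tangent bundle,
by which every tangent space is identified with `ℝ⁴`. -/

/-- The closed `4`-manifold `S¹ × T³`, where `T³ = (ℝ / ℤ)³`. -/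
abbrev Mfd : Type := UnitAddCircle × (Fin 3 → UnitAddCircle)

/-- The tangent space of `S¹ × T³` at any point, in the global frame `∂₀, …, ∂₃`. -/
abbrev TangentVec : Type := Fin 4 → ℝ

/-- The universal covering `ℝ⁴ → S¹ × T³`. -/
def covering (y : TangentVec) : Mfd :=
  ((y 0 : UnitAddCircle), fun i : Fin 3 => ((y i.succ : ℝ) : UnitAddCircle))

/-- The coordinate vector `∂ᵢ`. -/
def frame (i : Fin 4) : TangentVec := Pi.single i 1

/-- The partial derivative `∂ᵢ u` of a function on `S¹ × T³`. -/
def partialDeriv (i : Fin 4) (u : Mfd → ℝ) (p : Mfd) : ℝ :=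
  deriv (fun s : ℝ => u (p + covering (s • frame i))) 0

/-- A function on the circle `ℝ / ℤ` is smooth. -/
def SmoothOnCircle (u : UnitAddCircle → ℝ) : Prop :=
  ContDiff ℝ (⊤ : ℕ∞) (fun s : ℝ => u (s : UnitAddCircle))

/-- The derivative of a function on the circle `ℝ / ℤ`. -/
def circleDeriv (u : UnitAddCircle → ℝ) (t : UnitAddCircle) : ℝ :=
  deriv (fun s : ℝ => u (t + (s : UnitAddCircle))) 0

/-- A field of `k`-forms on `S¹ × T³`. -/
abbrev DiffForm (k : ℕ) : Type := Mfd → TangentVec [⋀^Fin k]→L[ℝ] ℝ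

/-- The exterior derivative: pull back to `ℝ⁴` by the covering `y ↦ p + y`, and differentiate
there at the origin. -/
def extD {k : ℕ} (ω : DiffForm k) : DiffForm (k + 1) :=
  fun p => extDeriv (fun y : TangentVec => ω (p + covering y)) 0

/-- The form `dx^{I 0} ∧ … ∧ dx^{I (k-1)}`, that is
`(v₀, …, v_{k-1}) ↦ ∑_σ sgn σ ∏ₐ dx^{I a}(v_{σ a})`. -/
def dx {k : ℕ} (I : Fin k → Fin 4) : TangentVec [⋀^Fin k]→L[ℝ] ℝ :=
  ContinuousMultilinearMap.alternatization
    ((ContinuousMultilinearMap.mkPiAlgebra ℝ (Fin k) ℝ).compContinuousLinearMap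
      (fun a => (ContinuousLinearMap.proj (I a) : TangentVec →L[ℝ] ℝ)))

/-! ## Metrics, scalar products and the Hodge operator -/

/-- A field of bilinear forms, given by its components in the coordinate frame. -/
abbrev BilinField : Type := Mfd → Matrix (Fin 4) (Fin 4) ℝ

/-- The scalar product of two `(k,0)`-tensors at `p`, i.e. `∑ A(E_I) B(E_I)` over an orthonormal
basis `E`, written in the coordinate frame. -/
def tensorInner (g : BilinField) (p : Mfd) {k : ℕ} (A B : (Fin k → Fin 4) → ℝ) : ℝ :=
  ∑ I : Fin k → Fin 4, ∑ J : Fin k → Fin 4, (∏ a, (g p)⁻¹ (I a) (J a)) * A I * B J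

/-- The components of a `k`-form in the coordinate frame. -/
def components {k : ℕ} (η : TangentVec [⋀^Fin k]→L[ℝ] ℝ) (I : Fin k → Fin 4) : ℝ :=
  η (fun a => frame (I a))

/-- The tensor norm `‖η‖²` of a `k`-form. -/
def normSq (g : BilinField) {k : ℕ} (η : DiffForm k) (p : Mfd) : ℝ :=
  tensorInner g p (components (η p)) (components (η p))

/-- The scalar product `⟨ω, η⟩_g = (1 / k!) ⟨ω, η⟩` of `k`-forms, for which the
`E*_{i₁} ∧ … ∧ E*_{i_k}`, `i₁ < … < i_k`, are orthonormal. -/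
def formInner (g : BilinField) (p : Mfd) {k : ℕ} (ω η : TangentVec [⋀^Fin k]→L[ℝ] ℝ) : ℝ :=
  (k.factorial : ℝ)⁻¹ * tensorInner g p (components ω) (components η)

/-- The bilinear form `g^η(X, Y) = ⟨X ⌟ η, Y ⌟ η⟩_g`; for a `1`-form this is `η(X) η(Y)`. -/
def contractedSquare (g : BilinField) {k : ℕ} (η : DiffForm (k + 1)) : BilinField :=
  fun p => Matrix.of fun i j =>
    formInner g p ((η p).curryLeft (frame i)) ((η p).curryLeft (frame j))

/-- The Riemannian volume form, for the orientation `dt ∧ dx¹ ∧ dx² ∧ dx³`; the degree is any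
`N` with `N = 4`. -/
def volForm (g : BilinField) {N : ℕ} (h : N = 4) : DiffForm N :=
  fun p => Real.sqrt (g p).det • dx (Fin.cast h)

/-- `ω(v₀, …, v_{k-1}, ·, …, ·)`. -/
def insertVectors {m : ℕ} : (k : ℕ) → (Fin k → TangentVec) →
    (TangentVec [⋀^Fin (m + k)]→L[ℝ] ℝ) → TangentVec [⋀^Fin m]→L[ℝ] ℝ
  | 0, _, ω => ω
  | k + 1, v, ω => insertVectors k (fun a => v a.succ) (ContinuousAlternatingMap.curryLeft ω (v 0))

/-- The component `η^I` of a `k`-form, all indices raised by the metric. -/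
def raised (g : BilinField) {k : ℕ} (η : DiffForm k) (p : Mfd) (I : Fin k → Fin 4) : ℝ :=
  ∑ J : Fin k → Fin 4, (∏ a, (g p)⁻¹ (I a) (J a)) * components (η p) J

/-- The Hodge operator, `*η = (1 / k!) ∑_I η^I vol(∂_{I 0}, …, ∂_{I (k-1)}, ·, …, ·)`, so that
`ω ∧ *η = ⟨ω, η⟩_g vol`. -/
def hodgeStar (g : BilinField) {k m : ℕ} (h : m + k = 4) (η : DiffForm k) : DiffForm m :=
  fun p => (k.factorial : ℝ)⁻¹ • ∑ I : Fin k → Fin 4,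
    raised g η p I • insertVectors k (fun a => frame (I a)) (volForm g h p)

/-- The codifferential `δ = - * d *` of a `3`-form on the `4`-manifold. -/
def codiff (g : BilinField) (T : DiffForm 3) : DiffForm 2 :=
  fun p => -(hodgeStar g (k := 2) (m := 2) rfl
    (extD (hodgeStar g (k := 3) (m := 1) rfl T)) p)

/-! ## Curvature -/

/-- The Christoffel symbol `Γᵏᵢⱼ` of the Levi-Civita connection. -/
def christoffel (g : BilinField) (k i j : Fin 4) (p : Mfd) : ℝ :=
  (1 / 2) * ∑ l, (g p)⁻¹ k l *
    (partialDeriv i (fun q => g q j l) p + partialDeriv j (fun q => g q i l) p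
      - partialDeriv l (fun q => g q i j) p)

/-- The `l`-th component of `Riem(∂ᵢ, ∂ⱼ)∂ₖ = ∇ᵢ∇ⱼ∂ₖ - ∇ⱼ∇ᵢ∂ₖ`. -/
def riemann (g : BilinField) (i j k l : Fin 4) (p : Mfd) : ℝ :=
  partialDeriv i (christoffel g l j k) p - partialDeriv j (christoffel g l i k) p
    + ∑ m, (christoffel g m j k p * christoffel g l i m p
      - christoffel g m i k p * christoffel g l j m p)

/-- The Ricci curvature `ric(X, Y) = tr (V ↦ Riem(V, X)Y)`. -/
def ricci (g : BilinField) : BilinField :=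
  fun p => Matrix.of fun i j => ∑ m, riemann g m i j m p

/-- The scalar curvature. -/
def scalarCurv (g : BilinField) (p : Mfd) : ℝ :=
  ∑ i, ∑ j, (g p)⁻¹ i j * ricci g p i j

/-- The Einstein tensor `G = ric - (R / 2) g`. -/
def einstein (g : BilinField) : BilinField :=
  fun p => ricci g p - (scalarCurv g p / 2) • g p

/-- The trace-free Ricci tensor in dimension `4`. -/
def traceFreeRicci (g : BilinField) : BilinField :=
  fun p => ricci g p - (scalarCurv g p / 4) • g p

/-- A field of `(k,0)`-tensors, given by its components in the coordinate frame. -/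
abbrev TensorField (k : ℕ) : Type := Mfd → (Fin k → Fin 4) → ℝ

/-- The Levi-Civita covariant derivative of a `(k,0)`-tensor field; the first index of the result
is the direction of differentiation. -/
def covDeriv (g : BilinField) {k : ℕ} (A : TensorField k) : TensorField (k + 1) :=
  fun p J => partialDeriv (J 0) (fun q => A q (Fin.tail J)) p
    - ∑ a : Fin k, ∑ s : Fin 4,
        christoffel g s (J 0) (Fin.tail J a) p * A p (Function.update (Fin.tail J) a s)

/-- The Weyl tensor `⟨C(X,Y)Z, W⟩` in dimension `4`: the curvature tensor `⟨Riem(X,Y)Z, W⟩`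
without its scalar part and its trace-free Ricci part. -/
def weyl (g : BilinField) : TensorField 4 :=
  fun p J =>
    let X := J 0
    let Y := J 1
    let Z := J 2
    let W := J 3
    let b := traceFreeRicci g p
    (∑ m, riemann g X Y Z m p * g p m W)
      - (1 / 12) * scalarCurv g p * (g p X W * g p Y Z - g p Y W * g p X Z)
      - (1 / 2) * (b X W * g p Y Z - b Y W * g p X Z + g p X W * b Y Z - g p Y W * b X Z)

/-- The Bach tensor `Bᵢⱼ = ∇ᵏ∇ˡ C_{kijl} + ½ ricᵏˡ C_{kijl}`. -/
def bach (g : BilinField) : BilinField :=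
  fun p => Matrix.of fun i j =>
    ∑ k, ∑ l, ∑ k', ∑ l', (g p)⁻¹ k k' * (g p)⁻¹ l l' *
      (covDeriv g (covDeriv g (weyl g)) p ![k', l', k, i, j, l]
        + (1 / 2) * ricci g p k' l' * weyl g p ![k, i, j, l])

/-! ## The equations of motion -/

/-- The right-hand side of the torsion equation, `3 γ₁ T - γ₂ dδT`. -/
def torsionExpr (γ₁ γ₂ : ℝ) (g : BilinField) (T : DiffForm 3) : DiffForm 3 :=
  fun p => (3 * γ₁) • T p - γ₂ • extD (codiff g T) p

/-- The right-hand side of the metric equation,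
`α G - β B + γ₁ (-6 g^{*T} + ½ ‖T‖² g) - γ₂ (-2 g^{d*T} + ½ ‖δT‖² g)`. -/
def metricExpr (α β γ₁ γ₂ : ℝ) (g : BilinField) (T : DiffForm 3) : BilinField :=
  fun p => α • einstein g p - β • bach g p
    + γ₁ • (-(6 : ℝ) • contractedSquare g (k := 0) (hodgeStar g (k := 3) (m := 1) rfl T) p
        + ((1 / 2) * normSq g T p) • g p)
    - γ₂ • (-(2 : ℝ) • contractedSquare g (k := 1) (extD (hodgeStar g (k := 3) (m := 1) rfl T)) p
        + ((1 / 2) * normSq g (codiff g T) p) • g p)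

/-- `(S¹ × T³, g, T)` solves the equations of motion. -/
structure SolvesEquationsOfMotion (α β γ₁ γ₂ : ℝ) (g : BilinField) (T : DiffForm 3) : Prop where
  torsion_eq : ∀ p, torsionExpr γ₁ γ₂ g T p = 0
  metric_eq : ∀ p, metricExpr α β γ₁ γ₂ g T p = 0

/-! ## The warped product metric and the torsion form -/

/-- The warped product metric `dt² + f(t)² ((dx¹)² + (dx²)² + (dx³)²)`. -/
def warpedMetric (f : UnitAddCircle → ℝ) : BilinField :=
  fun p => Matrix.diagonal ![1, f p.1 ^ 2, f p.1 ^ 2, f p.1 ^ 2]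

/-- The `3`-form `τ(t) (dx¹ ∧ dx² + dx² ∧ dx³ + dx³ ∧ dx¹) ∧ dt`. -/
def torsionForm (τ : UnitAddCircle → ℝ) : DiffForm 3 :=
  fun p => τ p.1 • (dx ![1, 2, 0] + dx ![2, 3, 0] + dx ![3, 1, 0])

end TorsionTorus

end

namespace TorsionTorus

/-! Everything depends on `t` alone, and the `dt`-`dt` component can be computed term by term. The
metric is conformally flat, since `g = f² ((dt/f)² + h_flat)`. So the Weyl tensor vanishes
(`weyl_warpedMetric`), and the Bach tensor, whose two terms both contain it, vanishes too. In `G_tt`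
the second derivatives of `f` cancel, which leaves `3 (f'/f)²`. The Hodge dual `*T = (τ/f)(dx¹ + dx²
+ dx³)` has no `dt` part, so `g^{*T}` contributes nothing and `½‖T‖²` gives `9 (τ/f²)²`. The form
`d*T = (τ/f)' dt ∧ (dx¹ + dx² + dx³)` is purely electric. With `Q = (f τ' - τ f')/f³`, one has
`g^{d*T}_tt = 3Q²` and `‖δT‖² = 6Q²`, so the last term is `-γ₂(-6 + 3)Q² = 3γ₂Q²`. All three
contributions are nonnegative. If their sum vanishes, each does, and the middle one forces `τ = 0`
pointwise. -/

theorem SmoothOnCircle.hasDerivAt {u : UnitAddCircle → ℝ} (hu : SmoothOnCircle u)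
    (t : UnitAddCircle) :
    HasDerivAt (fun s : ℝ => u (t + (s : UnitAddCircle))) (circleDeriv u t) 0 := by
  obtain ⟨r, rfl⟩ := QuotientAddGroup.mk_surjective t
  have h : Differentiable ℝ (fun s : ℝ => u (s : UnitAddCircle)) := hu.differentiable (by simp)
  have h2 : DifferentiableAt ℝ
      (fun s : ℝ => u ((r : UnitAddCircle) + (s : UnitAddCircle))) 0 :=
    (h.comp ((differentiable_const r).add differentiable_id)) 0
  exact h2.hasDerivAt

theorem circleDeriv_coe (u : UnitAddCircle → ℝ) (r : ℝ) :
    circleDeriv u (r : UnitAddCircle) = deriv (fun s : ℝ => u (s : UnitAddCircle)) r := by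
  have := deriv_comp_const_add (f := fun s : ℝ => u (s : UnitAddCircle)) r 0
  simpa [circleDeriv] using this

theorem SmoothOnCircle.circleDeriv {u : UnitAddCircle → ℝ} (hu : SmoothOnCircle u) :
    SmoothOnCircle (circleDeriv u) := by
  have h : ContDiff ℝ (⊤ : ℕ∞) (deriv fun s : ℝ => u (s : UnitAddCircle)) :=
    (contDiff_infty_iff_deriv.1 hu).2
  have e : (fun s : ℝ => TorsionTorus.circleDeriv u (s : UnitAddCircle))
      = deriv fun s : ℝ => u (s : UnitAddCircle) := funext (circleDeriv_coe u)
  unfold SmoothOnCircle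
  rwa [e]

theorem covering_smul_frame_zero (s : ℝ) :
    covering (s • frame 0) = ((s : UnitAddCircle), 0) := by
  ext <;> simp [covering, frame]

theorem covering_smul_frame_fst {i : Fin 4} (hi : i ≠ 0) (s : ℝ) :
    (covering (s • frame i)).1 = 0 := by
  simp [covering, frame, Pi.single_eq_of_ne hi.symm]

theorem partialDeriv_fst (u : UnitAddCircle → ℝ) {u' : ℝ} {p : Mfd} (i : Fin 4)
    
    (h : HasDerivAt (fun s : ℝ => u (p.1 + (s : UnitAddCircle))) u' 0) :
    partialDeriv i (fun q => u q.1) p = if i = 0 then u' else 0 := by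
  unfold partialDeriv
  split_ifs with hi
  · subst hi
    simpa [covering_smul_frame_zero] using h.deriv
  · simp [covering_smul_frame_fst hi]

theorem partialDeriv_const (i : Fin 4) (c : ℝ) (p : Mfd) :
    partialDeriv i (fun _ => c) p = 0 := by
  simp [partialDeriv]

/-! ### Connection and curvature of the warped product -/

/-- The diagonal entries of the warped metric. -/
def warpedEntry (f : ℝ) (i : Fin 4) : ℝ := if i = 0 then 1 else f ^ 2

theorem warpedMetric_apply (f : UnitAddCircle → ℝ) (p : Mfd) (i j : Fin 4) :
    warpedMetric f p i j = if i = j then warpedEntry (f p.1) i else 0 := by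
  fin_cases i <;> fin_cases j <;> simp [warpedMetric, warpedEntry]

theorem warpedMetric_eq_diagonal (f : UnitAddCircle → ℝ) (p : Mfd) :
    warpedMetric f p = Matrix.diagonal (warpedEntry (f p.1)) := by
  ext i j
  rw [warpedMetric_apply, Matrix.diagonal_apply]

theorem warpedEntry_ne_zero {f : ℝ} (hf : f ≠ 0) (i : Fin 4) : warpedEntry f i ≠ 0 := by
  unfold warpedEntry
  split_ifs <;> simp [hf]

theorem warpedMetric_inv_apply {f : UnitAddCircle → ℝ} {p : Mfd} (hf : f p.1 ≠ 0) (i j : Fin 4) :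
    (warpedMetric f p)⁻¹ i j = if i = j then (warpedEntry (f p.1) i)⁻¹ else 0 := by
  have h : (warpedMetric f p)⁻¹ = Matrix.diagonal fun i => (warpedEntry (f p.1) i)⁻¹ := by
    apply Matrix.inv_eq_right_inv
    rw [warpedMetric_eq_diagonal, Matrix.diagonal_mul_diagonal, ← Matrix.diagonal_one]
    congr 1
    funext i
    exact mul_inv_cancel₀ (warpedEntry_ne_zero hf i)
  rw [h, Matrix.diagonal_apply]

theorem warpedMetric_det (f : UnitAddCircle → ℝ) (p : Mfd) :
    (warpedMetric f p).det = (f p.1 ^ 3) ^ 2 := by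
  simp [warpedMetric, Matrix.det_diagonal, Fin.prod_univ_four]
  ring

/-- The array of the Christoffel symbols of a warped metric, with `Γ⁰ᵢᵢ = a` and
`Γⁱ₀ᵢ = Γⁱᵢ₀ = b`. -/
def warpedGamma (k i j : Fin 4) (a b : ℝ) : ℝ :=
  if k = 0 then (if i = j ∧ i ≠ 0 then a else 0)
  else if (i = 0 ∧ j = k) ∨ (j = 0 ∧ i = k) then b else 0

theorem partialDeriv_warpedMetric {f : UnitAddCircle → ℝ} (hf : SmoothOnCircle f)
    (i j l : Fin 4) (p : Mfd) :
    partialDeriv i (fun q => warpedMetric f q j l) p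
      = if i = 0 ∧ j = l ∧ j ≠ 0 then 2 * f p.1 * circleDeriv f p.1 else 0 := by
  simp only [warpedMetric_apply, warpedEntry]
  by_cases h : j = l ∧ j ≠ 0
  · have h1 := partialDeriv_fst (fun t => f t ^ 2) i ((hf.hasDerivAt p.1).fun_pow 2)
    simpa [h, h.1 ▸ h.2] using h1
  · by_cases hj : j = l
    · have hj0 : j = 0 := by tauto
      simp [hj0, partialDeriv_const]
    · simp [hj, partialDeriv_const]

theorem christoffel_warpedMetric {f : UnitAddCircle → ℝ} (hf : SmoothOnCircle f)
    (hf_pos : ∀ t, 0 < f t) (k i j : Fin 4) (p : Mfd) :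
    christoffel (warpedMetric f) k i j p
      = warpedGamma k i j (-(f p.1 * circleDeriv f p.1)) (circleDeriv f p.1 / f p.1) := by
  have h0 := (hf_pos p.1).ne'
  simp only [christoffel, partialDeriv_warpedMetric hf, warpedMetric_inv_apply h0, warpedEntry,
    ite_mul, zero_mul, Finset.sum_ite_eq, Finset.mem_univ, if_true, warpedGamma]
  fin_cases k <;> fin_cases i <;> fin_cases j <;> simp <;> field_simp

/-- `warpedGamma` is linear in its two real arguments, so its `t`-derivative is the same array
filled with the derivatives of `-f f'` and `f'/f`. -/
theorem partialDeriv_christoffel_warpedMetric {f : UnitAddCircle → ℝ} (hf : SmoothOnCircle f)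
    (hf_pos : ∀ t, 0 < f t) (i k l m : Fin 4) (p : Mfd) :
    partialDeriv i (christoffel (warpedMetric f) k l m) p
      = if i = 0 then warpedGamma k l m
          (-(circleDeriv f p.1 ^ 2 + f p.1 * circleDeriv (circleDeriv f) p.1))
          ((circleDeriv (circleDeriv f) p.1 * f p.1 - circleDeriv f p.1 ^ 2) / f p.1 ^ 2)
        else 0 := by
  have h0 := (hf_pos p.1).ne'
  rw [show christoffel (warpedMetric f) k l m
      = fun q : Mfd => warpedGamma k l m (-(f q.1 * circleDeriv f q.1))
          (circleDeriv f q.1 / f q.1) from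
    funext fun q => christoffel_warpedMetric hf hf_pos k l m q]
  refine partialDeriv_fst (fun t => warpedGamma k l m (-(f t * circleDeriv f t))
    (circleDeriv f t / f t)) i ?_
  have h1 := hf.hasDerivAt p.1
  have h2 := hf.circleDeriv.hasDerivAt p.1
  have ha := (h1.fun_mul h2).fun_neg
  have hb := h2.fun_div h1 (by simpa using h0)
  simp only [QuotientAddGroup.mk_zero, add_zero] at ha hb
  unfold warpedGamma
  split_ifs
  · exact ha.congr_deriv (by ring)
  · exact hasDerivAt_const _ _
  · exact hb.congr_deriv (by ring)
  · exact hasDerivAt_const _ _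

/-- The sectional curvature of the plane spanned by `∂ᵢ` and `∂ⱼ`, `i ≠ j`, for a warped metric:
it is `x` if the plane contains `∂ₜ`, and `y` otherwise. -/
def warpedSec (x y : ℝ) (i j : Fin 4) : ℝ := if i = 0 ∨ j = 0 then x else y

/-- The coordinate planes diagonalize the curvature operator: planes containing `∂ₜ` have sectional
curvature `-f''/f`, spatial planes `-(f'/f)²`. -/
theorem riemann_warpedMetric {f : UnitAddCircle → ℝ} (hf : SmoothOnCircle f)
    (hf_pos : ∀ t, 0 < f t) (i j k l : Fin 4) (p : Mfd) :
    riemann (warpedMetric f) i j k l p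
      = warpedSec (-(circleDeriv (circleDeriv f) p.1 / f p.1)) (-(circleDeriv f p.1 / f p.1) ^ 2)
          i j * ((if i = l then warpedMetric f p j k else 0)
            - if j = l then warpedMetric f p i k else 0) := by
  have h0 := (hf_pos p.1).ne'
  simp only [riemann, christoffel_warpedMetric hf hf_pos,
    partialDeriv_christoffel_warpedMetric hf hf_pos, Fin.sum_univ_four, warpedMetric_apply,
    warpedGamma, warpedSec, warpedEntry]
  -- Only the values of `f`, `f'`, `f''` at the point matter; as independent reals they turn each
  -- index case into a rational identity.
  generalize circleDeriv (circleDeriv f) p.1 = c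
  generalize circleDeriv f p.1 = b
  generalize f p.1 = a at *
  fin_cases i <;> fin_cases j <;> fin_cases k <;> fin_cases l <;> simp <;> field_simp <;> ring

theorem ricci_warpedMetric {f : UnitAddCircle → ℝ} (hf : SmoothOnCircle f)
    (hf_pos : ∀ t, 0 < f t) (i j : Fin 4) (p : Mfd) :
    ricci (warpedMetric f) p i j
      = (if i = 0 then -(3 * (circleDeriv (circleDeriv f) p.1 / f p.1))
          else -(circleDeriv (circleDeriv f) p.1 / f p.1) - 2 * (circleDeriv f p.1 / f p.1) ^ 2)
        * warpedMetric f p i j := by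
  simp only [ricci, Matrix.of_apply, riemann_warpedMetric hf hf_pos, Fin.sum_univ_four,
    warpedMetric_apply, warpedSec]
  fin_cases i <;> fin_cases j <;> simp <;> ring

theorem scalarCurv_warpedMetric {f : UnitAddCircle → ℝ} (hf : SmoothOnCircle f)
    (hf_pos : ∀ t, 0 < f t) (p : Mfd) :
    scalarCurv (warpedMetric f) p
      = -(6 * (circleDeriv (circleDeriv f) p.1 / f p.1)) - 6 * (circleDeriv f p.1 / f p.1) ^ 2 := by
  have h0 := (hf_pos p.1).ne'
  have h1 := warpedEntry_ne_zero h0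
  simp [scalarCurv, ricci_warpedMetric hf hf_pos, warpedMetric_inv_apply h0, warpedMetric_apply,
    Fin.sum_univ_four, mul_comm, h1]
  ring

theorem einstein_warpedMetric_zero {f : UnitAddCircle → ℝ} (hf : SmoothOnCircle f)
    (hf_pos : ∀ t, 0 < f t) (p : Mfd) :
    einstein (warpedMetric f) p 0 0 = 3 * (circleDeriv f p.1 / f p.1) ^ 2 := by
  simp [einstein, ricci_warpedMetric hf hf_pos, scalarCurv_warpedMetric hf hf_pos,
    warpedMetric_apply, warpedEntry]
  ring

/-! ### Conformal flatness -/

/-- Relative to `g`, the trace-free Ricci tensor has eigenvalues `λ = μ(-3, 1, 1, 1)` with `μ =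
(f''/f - (f'/f)²)/2`. The sectional curvatures equal `R/12 + (λᵢ + λⱼ)/2`, so no Weyl part remains.
-/
theorem weyl_warpedMetric {f : UnitAddCircle → ℝ} (hf : SmoothOnCircle f)
    (hf_pos : ∀ t, 0 < f t) : weyl (warpedMetric f) = 0 := by
  funext p J
  have hb : ∀ i j, traceFreeRicci (warpedMetric f) p i j
      = (if i = 0 then -3 else 1) * ((circleDeriv (circleDeriv f) p.1 / f p.1
          - (circleDeriv f p.1 / f p.1) ^ 2) / 2) * warpedMetric f p i j := by
    intro i j
    simp only [traceFreeRicci, Matrix.sub_apply, Matrix.smul_apply, smul_eq_mul,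
      ricci_warpedMetric hf hf_pos, scalarCurv_warpedMetric hf hf_pos]
    split_ifs <;> ring
  simp only [weyl, riemann_warpedMetric hf hf_pos, hb, scalarCurv_warpedMetric hf hf_pos,
    Pi.zero_apply, warpedMetric_apply, mul_ite, mul_zero, Finset.sum_ite_eq', Finset.mem_univ,
    if_true, warpedSec]
  generalize J 0 = i
  generalize J 1 = j
  generalize J 2 = k
  generalize J 3 = l
  generalize circleDeriv (circleDeriv f) p.1 / f p.1 = c
  generalize circleDeriv f p.1 / f p.1 = b
  generalize f p.1 = a
  have h0 : warpedEntry a 0 = 1 := by simp [warpedEntry]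
  have hi : ∀ i, i ≠ 0 → warpedEntry a i = a ^ 2 := fun i hi => by simp [warpedEntry, hi]
  fin_cases i <;> fin_cases j <;> fin_cases k <;> fin_cases l <;>
    simp [h0, hi 1, hi 2, hi 3] <;> ring

theorem covDeriv_zero (g : BilinField) {k : ℕ} : covDeriv g (0 : TensorField k) = 0 := by
  funext p J
  simp [covDeriv, partialDeriv_const]

theorem bach_eq_zero_of_weyl_eq_zero {g : BilinField} (h : weyl g = 0) : bach g = 0 := by
  funext p
  ext i j
  simp [bach, h, covDeriv_zero]

/-! ### Forms in components: real scale factors times integer arrays -/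

theorem dx_apply {k : ℕ} (I : Fin k → Fin 4) (v : Fin k → TangentVec) :
    dx I v = (Matrix.of fun b a => v b (I a)).det := by
  simp [dx, ContinuousMultilinearMap.alternatization_apply_apply, Matrix.det_apply]

/-- The generalized Kronecker symbol. -/
def kron {k : ℕ} (I J : Fin k → Fin 4) : ℤ :=
  (Matrix.of fun b a => if J b = I a then (1 : ℤ) else 0).det

/-- Integer values make the index sums below decidable by evaluation. -/
theorem components_dx {k : ℕ} (I J : Fin k → Fin 4) :
    components (dx I) J = kron I J := by
  rw [components, dx_apply, kron, Int.cast_det]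
  congr 1
  ext a b
  simp [frame, Pi.single_apply, eq_comm]

theorem components_add {k : ℕ} (ω η : TangentVec [⋀^Fin k]→L[ℝ] ℝ) (I : Fin k → Fin 4) :
    components (ω + η) I = components ω I + components η I := rfl

theorem components_smul {k : ℕ} (c : ℝ) (ω : TangentVec [⋀^Fin k]→L[ℝ] ℝ) (I : Fin k → Fin 4) :
    components (c • ω) I = c * components ω I := rfl

/-- The number of spatial indices in a multi-index. -/
def spatialCount {k : ℕ} (I : Fin k → Fin 4) : ℕ := ∑ a, if I a = 0 then 0 else 1

/-- The inverse metric is diagonal, and each spatial index contributes a factor `f⁻²`. -/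
theorem prod_warpedMetric_inv {f : UnitAddCircle → ℝ} {p : Mfd} (hf : f p.1 ≠ 0) {k : ℕ}
    (I J : Fin k → Fin 4) :
    ∏ a, (warpedMetric f p)⁻¹ (I a) (J a)
      = if I = J then ((f p.1 ^ 2)⁻¹) ^ spatialCount I else 0 := by
  simp only [warpedMetric_inv_apply hf, Finset.prod_ite_zero, Finset.mem_univ, true_imp_iff,
    spatialCount, ← Finset.prod_pow_eq_pow_sum, warpedEntry, funext_iff]
  congr 1
  refine Finset.prod_congr rfl fun a _ => ?_
  split_ifs <;> simp

theorem tensorInner_warpedMetric {f : UnitAddCircle → ℝ} {p : Mfd} (hf : f p.1 ≠ 0) {k : ℕ}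
    (A B : (Fin k → Fin 4) → ℝ) :
    tensorInner (warpedMetric f) p A B
      = ∑ I, ((f p.1 ^ 2)⁻¹) ^ spatialCount I * A I * B I := by
  simp [tensorInner, prod_warpedMetric_inv hf, ite_mul]

/-- If the array `z` of integers is concentrated on the multi-indices with `n` spatial indices,
the square of the warped norm of `c z` is read off from that of `z`. -/
theorem tensorInner_warpedMetric_self {f : UnitAddCircle → ℝ} {p : Mfd} (hf : f p.1 ≠ 0) {k : ℕ}
    {A : (Fin k → Fin 4) → ℝ} {c : ℝ} {z : (Fin k → Fin 4) → ℤ} {n : ℕ}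
    (hA : ∀ I, A I = c * z I) (hz : ∀ I, z I ≠ 0 → spatialCount I = n) :
    tensorInner (warpedMetric f) p A A = ((f p.1 ^ 2)⁻¹) ^ n * c ^ 2 * (∑ I, z I ^ 2 : ℤ) := by
  rw [tensorInner_warpedMetric hf, Int.cast_sum, Finset.mul_sum]
  refine Finset.sum_congr rfl fun I _ => ?_
  rw [hA]
  by_cases h : z I = 0
  · simp [h]
  · rw [hz I h]
    push_cast
    ring

theorem raised_warpedMetric {f : UnitAddCircle → ℝ} {p : Mfd} (hf : f p.1 ≠ 0) {k : ℕ}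
    {η : DiffForm k} {c : ℝ} {z : (Fin k → Fin 4) → ℤ} {n : ℕ}
    (hη : ∀ I, components (η p) I = c * z I) (hz : ∀ I, z I ≠ 0 → spatialCount I = n)
    (I : Fin k → Fin 4) :
    raised (warpedMetric f) η p I = ((f p.1 ^ 2)⁻¹) ^ n * c * z I := by
  simp only [raised, prod_warpedMetric_inv hf, ite_mul, zero_mul, Finset.sum_ite_eq,
    Finset.mem_univ, if_true, hη]
  by_cases h : z I = 0
  · simp [h]
  · rw [hz I h]
    ring

theorem components_volForm_warpedMetric {f : UnitAddCircle → ℝ} (hf_pos : ∀ t, 0 < f t)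
    (p : Mfd) {N : ℕ} (h : N = 4) (I : Fin N → Fin 4) :
    components (volForm (warpedMetric f) h p) I = f p.1 ^ 3 * kron (Fin.cast h) I := by
  rw [volForm, components_smul, components_dx, warpedMetric_det,
    Real.sqrt_sq (pow_pos (hf_pos p.1) 3).le]

/-- Raising `n` spatial indices gives `f⁻²ⁿ`, the volume form gives `f³`, and what remains is an
integer sum. In the uses below `ext I` is `I` followed by `J`, supplied as an explicit vector for
each degree. -/
theorem components_hodgeStar {f : UnitAddCircle → ℝ} (hf_pos : ∀ t, 0 < f t) {p : Mfd}
    {k m : ℕ} (h : m + k = 4) {η : DiffForm k} {c : ℝ} {z : (Fin k → Fin 4) → ℤ} {n : ℕ}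
    (hη : ∀ I, components (η p) I = c * z I) (hz : ∀ I, z I ≠ 0 → spatialCount I = n)
    (J : Fin m → Fin 4) (ext : (Fin k → Fin 4) → Fin (m + k) → Fin 4)
    (hext : ∀ (I : Fin k → Fin 4) (ω : TangentVec [⋀^Fin (m + k)]→L[ℝ] ℝ),
      components (insertVectors k (fun a => frame (I a)) ω) J = components ω (ext I)) :
    components (hodgeStar (warpedMetric f) h η p) J
      = ((f p.1 ^ 2)⁻¹) ^ n * f p.1 ^ 3 * c
        * ((k.factorial : ℝ)⁻¹ * (∑ I, z I * kron (Fin.cast h) (ext I) : ℤ)) := by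
  have hsum : components (hodgeStar (warpedMetric f) h η p) J
      = (k.factorial : ℝ)⁻¹ * ∑ I : Fin k → Fin 4, raised (warpedMetric f) η p I *
        components (insertVectors k (fun a => frame (I a)) (volForm (warpedMetric f) h p)) J := by
    simp [hodgeStar, components]
  rw [hsum]
  simp only [hext, components_volForm_warpedMetric hf_pos,
    raised_warpedMetric (hf_pos p.1).ne' hη hz]
  push_cast
  rw [Finset.mul_sum, Finset.mul_sum, Finset.mul_sum]
  exact Finset.sum_congr rfl fun I _ => by ring

theorem components_insertVectors_three (I : Fin 3 → Fin 4) (J : Fin 1 → Fin 4)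
    (ω : TangentVec [⋀^Fin (1 + 3)]→L[ℝ] ℝ) :
    components (insertVectors 3 (fun a => frame (I a)) ω) J
      = components ω ![I 0, I 1, I 2, J 0] := by
  simp only [insertVectors, components, ContinuousAlternatingMap.curryLeft_apply_apply]
  congr 1
  funext a
  fin_cases a <;> rfl

theorem components_insertVectors_two (I : Fin 2 → Fin 4) (J : Fin 2 → Fin 4)
    (ω : TangentVec [⋀^Fin (2 + 2)]→L[ℝ] ℝ) :
    components (insertVectors 2 (fun a => frame (I a)) ω) J
      = components ω ![I 0, I 1, J 0, J 1] := by
  simp only [insertVectors, components, ContinuousAlternatingMap.curryLeft_apply_apply]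
  congr 1
  funext a
  fin_cases a <;> rfl

theorem ext_components {k : ℕ} {ω η : TangentVec [⋀^Fin k]→L[ℝ] ℝ}
    (h : ∀ I, components ω I = components η I) : ω = η := by
  apply ContinuousAlternatingMap.toAlternatingMap_injective
  refine (Pi.basisFun ℝ (Fin 4)).ext_alternating fun I _ => ?_
  simpa [components, frame] using h I

/-! ### The torsion form, its Hodge dual and codifferential -/

/-- The components of `(dx¹ ∧ dx² + dx² ∧ dx³ + dx³ ∧ dx¹) ∧ dt`. -/
def torsionArray (I : Fin 3 → Fin 4) : ℤ :=
  kron ![1, 2, 0] I + kron ![2, 3, 0] I + kron ![3, 1, 0] I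

/-- The components of `dt ∧ (dx¹ + dx² + dx³)`. -/
def electricArray (I : Fin 2 → Fin 4) : ℤ := kron ![0, 1] I + kron ![0, 2] I + kron ![0, 3] I

/-- The components of `dx¹ ∧ dx² + dx² ∧ dx³ + dx³ ∧ dx¹`. -/
def magneticArray (I : Fin 2 → Fin 4) : ℤ := kron ![1, 2] I + kron ![2, 3] I + kron ![3, 1] I

theorem components_torsionForm (τ : UnitAddCircle → ℝ) (p : Mfd) (I : Fin 3 → Fin 4) :
    components (torsionForm τ p) I = τ p.1 * torsionArray I := by
  simp only [torsionForm, components_smul, components_add, components_dx, torsionArray]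
  push_cast
  rfl

theorem torsionArray_spatialCount : ∀ I, torsionArray I ≠ 0 → spatialCount I = 2 := by
  decide +kernel

theorem electricArray_spatialCount : ∀ I, electricArray I ≠ 0 → spatialCount I = 1 := by
  decide +kernel

theorem magneticArray_spatialCount : ∀ I, magneticArray I ≠ 0 → spatialCount I = 2 := by
  decide +kernel

/-- The `6 = 3!` orderings of each triple cancel the `1/k!` of the Hodge operator. The sign is
positive because, for instance, `(1, 2, 0, 3)` is an even permutation. -/
theorem sum_torsionArray_mul_kron : ∀ J : Fin 1 → Fin 4,
    ∑ I, torsionArray I * kron (Fin.cast (rfl : 1 + 3 = 4)) ![I 0, I 1, I 2, J 0]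
      = 6 * (kron ![1] J + kron ![2] J + kron ![3] J) := by
  decide +kernel

theorem sum_electricArray_mul_kron : ∀ J : Fin 2 → Fin 4,
    ∑ I, electricArray I * kron (Fin.cast (rfl : 2 + 2 = 4)) ![I 0, I 1, J 0, J 1]
      = 2 * magneticArray J := by
  decide +kernel

theorem electricArray_eq : ∀ I : Fin 2 → Fin 4, electricArray I
    = (if I 0 = 0 then kron ![1] ![I 1] + kron ![2] ![I 1] + kron ![3] ![I 1] else 0)
      - if I 1 = 0 then kron ![1] ![I 0] + kron ![2] ![I 0] + kron ![3] ![I 0] else 0 := by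
  decide +kernel

theorem normSq_torsionForm {f : UnitAddCircle → ℝ} (hf_pos : ∀ t, 0 < f t)
    (τ : UnitAddCircle → ℝ) (p : Mfd) :
    normSq (warpedMetric f) (torsionForm τ) p = 18 * (τ p.1 / f p.1 ^ 2) ^ 2 := by
  have h0 := (hf_pos p.1).ne'
  -- Three basis forms, each with `3!` orderings of its indices.
  have hs : ∑ I, torsionArray I ^ 2 = 18 := by decide +kernel
  rw [normSq, tensorInner_warpedMetric_self h0 (components_torsionForm τ p)
    torsionArray_spatialCount, hs]
  push_cast
  field_simp

theorem hodgeStar_torsionForm {f : UnitAddCircle → ℝ} (hf_pos : ∀ t, 0 < f t)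
    (τ : UnitAddCircle → ℝ) (p : Mfd) :
    hodgeStar (warpedMetric f) (k := 3) (m := 1) rfl (torsionForm τ) p
      = (τ p.1 / f p.1) • (dx ![1] + dx ![2] + dx ![3]) := by
  have h0 := (hf_pos p.1).ne'
  refine ext_components fun J => ?_
  rw [components_hodgeStar hf_pos rfl (components_torsionForm τ p) torsionArray_spatialCount J
    (fun I => ![I 0, I 1, I 2, J 0]) (fun I ω => components_insertVectors_three I J ω),
    sum_torsionArray_mul_kron]
  simp only [components_smul, components_add, components_dx, Nat.factorial]
  push_cast
  field_simp

theorem hasFDerivAt_comp_covering {u : UnitAddCircle → ℝ} {u' : ℝ} {p : Mfd}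
    (hu : HasDerivAt (fun s : ℝ => u (p.1 + (s : UnitAddCircle))) u' 0) :
    HasFDerivAt (fun y : TangentVec => u (p + covering y).1)
      (u' • (ContinuousLinearMap.proj 0 : TangentVec →L[ℝ] ℝ)) 0 :=
  HasDerivAt.comp_hasFDerivAt (h₂ := fun s : ℝ => u (p.1 + (s : UnitAddCircle)))
    (f := fun y : TangentVec => y 0) (0 : TangentVec) hu
    (ContinuousLinearMap.proj (R := ℝ) (φ := fun _ : Fin 4 => ℝ) 0).hasFDerivAt

/-- This is `d(u ω) = u' dt ∧ ω` for a form `ω` with constant coefficients. -/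
theorem components_extD_smul {u : UnitAddCircle → ℝ} {u' : ℝ} {p : Mfd}
    (hu : HasDerivAt (fun s : ℝ => u (p.1 + (s : UnitAddCircle))) u' 0)
    (ω : TangentVec [⋀^Fin 1]→L[ℝ] ℝ) (I : Fin 2 → Fin 4) :
    components (extD (fun q => u q.1 • ω) p) I
      = u' * ((if I 0 = 0 then components ω ![I 1] else 0)
          - if I 1 = 0 then components ω ![I 0] else 0) := by
  have h := (hasFDerivAt_comp_covering hu).smul_const ω
  have hd : ∀ w, fderiv ℝ (fun y : TangentVec => (u (p + covering y).1 • ω) w) 0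
      = ω w • (u' • (ContinuousLinearMap.proj 0 : TangentVec →L[ℝ] ℝ)) := fun w =>
    ((hasFDerivAt_comp_covering hu).mul_const (ω w)).fderiv
  have e0 : ∀ v : Fin 2 → TangentVec, Fin.removeNth 0 v = ![v 1] := fun v => by
    funext a; fin_cases a; rfl
  have e1 : ∀ v : Fin 2 → TangentVec, Fin.removeNth 1 v = ![v 0] := fun v => by
    funext a; fin_cases a; rfl
  have ev : ∀ i : Fin 4, ![frame i] = fun a : Fin 1 => frame (![i] a) := fun i => by
    funext a; fin_cases a; rfl
  rw [components, extD, extDeriv_apply h.differentiableAt, Fin.sum_univ_two]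
  simp only [hd, e0, e1, ev]
  simp [components, frame, Pi.single_apply, eq_comm]
  split_ifs <;> ring

theorem components_extD_hodgeStar_torsionForm {f τ : UnitAddCircle → ℝ} (hf : SmoothOnCircle f)
    (hf_pos : ∀ t, 0 < f t) (hτ : SmoothOnCircle τ) (p : Mfd) (I : Fin 2 → Fin 4) :
    components (extD (hodgeStar (warpedMetric f) (k := 3) (m := 1) rfl (torsionForm τ)) p) I
      = ((f p.1 * circleDeriv τ p.1 - τ p.1 * circleDeriv f p.1) / f p.1 ^ 2)
        * electricArray I := by
  have h0 := (hf_pos p.1).ne'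
  have hu : HasDerivAt (fun s : ℝ => τ (p.1 + (s : UnitAddCircle)) / f (p.1 + (s : UnitAddCircle)))
      ((f p.1 * circleDeriv τ p.1 - τ p.1 * circleDeriv f p.1) / f p.1 ^ 2) 0 :=
    ((hτ.hasDerivAt p.1).fun_div (hf.hasDerivAt p.1) (by simpa using h0)).congr_deriv
      (by simp [mul_comm])
  rw [show hodgeStar (warpedMetric f) (k := 3) (m := 1) rfl (torsionForm τ)
      = fun q => (τ q.1 / f q.1) • (dx ![1] + dx ![2] + dx ![3]) from
    funext (hodgeStar_torsionForm hf_pos τ),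
    components_extD_smul (u := fun t => τ t / f t) hu, electricArray_eq]
  simp only [components_add, components_dx]
  push_cast
  rfl

/-- The Hodge operator turns the electric form `d*T` into a magnetic one, with scale factor `f⁻² f³
= f`; the norm then brings in `f⁻⁴` and the `3 · 2!` nonzero components. -/
theorem normSq_codiff_torsionForm {f τ : UnitAddCircle → ℝ} (hf : SmoothOnCircle f)
    (hf_pos : ∀ t, 0 < f t) (hτ : SmoothOnCircle τ) (p : Mfd) :
    normSq (warpedMetric f) (codiff (warpedMetric f) (torsionForm τ)) p
      = 6 * ((f p.1 * circleDeriv τ p.1 - τ p.1 * circleDeriv f p.1) / f p.1 ^ 3) ^ 2 := by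
  have h0 := (hf_pos p.1).ne'
  have hc : ∀ J, components (codiff (warpedMetric f) (torsionForm τ) p) J
      = -((f p.1 * circleDeriv τ p.1 - τ p.1 * circleDeriv f p.1) / f p.1)
        * magneticArray J := by
    intro J
    rw [codiff, ← neg_one_smul ℝ, components_smul, components_hodgeStar hf_pos rfl
      (components_extD_hodgeStar_torsionForm hf hf_pos hτ p) electricArray_spatialCount J
      (fun I => ![I 0, I 1, J 0, J 1]) (fun I ω => components_insertVectors_two I J ω),
      sum_electricArray_mul_kron]
    simp only [Nat.factorial]
    push_cast
    field_simp
  have hs : ∑ I, magneticArray I ^ 2 = 6 := by decide +kernel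
  rw [normSq, tensorInner_warpedMetric_self h0 hc magneticArray_spatialCount, hs]
  push_cast
  field_simp

theorem contractedSquare_extD_hodgeStar_torsionForm_zero {f τ : UnitAddCircle → ℝ}
    (hf : SmoothOnCircle f) (hf_pos : ∀ t, 0 < f t) (hτ : SmoothOnCircle τ) (p : Mfd) :
    contractedSquare (warpedMetric f) (k := 1)
        (extD (hodgeStar (warpedMetric f) (k := 3) (m := 1) rfl (torsionForm τ))) p 0 0
      = 3 * ((f p.1 * circleDeriv τ p.1 - τ p.1 * circleDeriv f p.1) / f p.1 ^ 3) ^ 2 := by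
  have h0 := (hf_pos p.1).ne'
  have hc : ∀ I : Fin 1 → Fin 4, components
      ((extD (hodgeStar (warpedMetric f) (k := 3) (m := 1) rfl (torsionForm τ)) p).curryLeft
        (frame 0)) I
      = ((f p.1 * circleDeriv τ p.1 - τ p.1 * circleDeriv f p.1) / f p.1 ^ 2)
        * electricArray ![0, I 0] := by
    intro I
    rw [← components_extD_hodgeStar_torsionForm hf hf_pos hτ, components, components,
      ContinuousAlternatingMap.curryLeft_apply_apply]
    congr 1
    funext a
    fin_cases a <;> rfl
  have hz : ∀ I : Fin 1 → Fin 4, electricArray ![0, I 0] ≠ 0 → spatialCount I = 1 := by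
    decide +kernel
  have hs : ∑ I : Fin 1 → Fin 4, electricArray ![0, I 0] ^ 2 = 3 := by decide +kernel
  simp only [contractedSquare, formInner, Matrix.of_apply]
  rw [tensorInner_warpedMetric_self h0 hc hz, hs, Nat.factorial_one]
  push_cast
  field_simp

theorem contractedSquare_hodgeStar_torsionForm_zero {f : UnitAddCircle → ℝ}
    (hf_pos : ∀ t, 0 < f t) (τ : UnitAddCircle → ℝ) (p : Mfd) :
    contractedSquare (warpedMetric f) (k := 0)
        (hodgeStar (warpedMetric f) (k := 3) (m := 1) rfl (torsionForm τ)) p 0 0 = 0 := by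
  simp [contractedSquare, formInner, tensorInner, components, hodgeStar_torsionForm hf_pos,
    dx_apply, frame]

/-! ### The `dt`-`dt` equation and its consequence -/

theorem metricExpr_warpedMetric_zero (α β γ₁ γ₂ : ℝ) {f τ : UnitAddCircle → ℝ}
    (hf : SmoothOnCircle f) (hf_pos : ∀ t, 0 < f t) (hτ : SmoothOnCircle τ) (p : Mfd) :
    metricExpr α β γ₁ γ₂ (warpedMetric f) (torsionForm τ) p 0 0
      = 3 * α * (circleDeriv f p.1 / f p.1) ^ 2 + 9 * γ₁ * (τ p.1 / f p.1 ^ 2) ^ 2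
        + 3 * γ₂ * ((f p.1 * circleDeriv τ p.1 - τ p.1 * circleDeriv f p.1)
          / f p.1 ^ 3) ^ 2 := by
  simp only [metricExpr, Matrix.add_apply, Matrix.sub_apply, Matrix.smul_apply, smul_eq_mul,
    einstein_warpedMetric_zero hf hf_pos, normSq_torsionForm hf_pos,
    bach_eq_zero_of_weyl_eq_zero (weyl_warpedMetric hf hf_pos),
    contractedSquare_hodgeStar_torsionForm_zero hf_pos,
    contractedSquare_extD_hodgeStar_torsionForm_zero hf hf_pos hτ,
    normSq_codiff_torsionForm hf hf_pos hτ, warpedMetric_apply, warpedEntry, if_true,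
    Pi.zero_apply, Matrix.zero_apply]
  ring

theorem eq_zero_of_solvesEquationsOfMotion {α β γ₁ γ₂ : ℝ} (hα : 0 < α) (hγ₁ : 0 < γ₁)
    (hγ₂ : 0 < γ₂) {f τ : UnitAddCircle → ℝ} (hf : SmoothOnCircle f) (hf_pos : ∀ t, 0 < f t)
    (hτ : SmoothOnCircle τ)
    (h : SolvesEquationsOfMotion α β γ₁ γ₂ (warpedMetric f) (torsionForm τ))
    (t : UnitAddCircle) : τ t = 0 := by
  -- The torus coordinate is arbitrary, as the expression depends on `t` alone.
  have h1 := metricExpr_warpedMetric_zero α β γ₁ γ₂ hf hf_pos hτ (t, 0)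
  rw [h.metric_eq, Matrix.zero_apply] at h1
  have h2 : 0 ≤ 3 * α * (circleDeriv f t / f t) ^ 2 := by positivity
  have h3 : 0 ≤ 3 * γ₂ * ((f t * circleDeriv τ t - τ t * circleDeriv f t) / f t ^ 3) ^ 2 := by
    positivity
  have h4 : 0 ≤ 9 * γ₁ * (τ t / f t ^ 2) ^ 2 := by positivity
  have h5 : 9 * γ₁ * (τ t / f t ^ 2) ^ 2 = 0 := by dsimp only at h1; linarith
  have h6 := (hf_pos t).ne'
  simpa [hγ₁.ne', h6] using h5

end TorsionTorus

theorem mainTheorem12 (α β γ₁ γ₂ : ℝ) (hα : 0 < α) (hγ₁ : 0 < γ₁) (hγ₂ : 0 < γ₂)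
    (f τ : UnitAddCircle → ℝ)
    (hf : TorsionTorus.SmoothOnCircle f) (hf_pos : ∀ t, 0 < f t)
    (hτ : TorsionTorus.SmoothOnCircle τ) :
    (∀ p : TorsionTorus.Mfd,
      TorsionTorus.metricExpr α β γ₁ γ₂ (TorsionTorus.warpedMetric f)
          (TorsionTorus.torsionForm τ) p 0 0
        = 3 * α * (TorsionTorus.circleDeriv f p.1 / f p.1) ^ 2
          + 9 * γ₁ * (τ p.1 / f p.1 ^ 2) ^ 2
          + 3 * γ₂ * ((f p.1 * TorsionTorus.circleDeriv τ p.1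
              - τ p.1 * TorsionTorus.circleDeriv f p.1) / f p.1 ^ 3) ^ 2) ∧
    (TorsionTorus.SolvesEquationsOfMotion α β γ₁ γ₂ (TorsionTorus.warpedMetric f)
        (TorsionTorus.torsionForm τ) →
      (∀ t, τ t = 0) ∧ TorsionTorus.torsionForm τ = 0) := by
  refine ⟨TorsionTorus.metricExpr_warpedMetric_zero α β γ₁ γ₂ hf hf_pos hτ, fun h => ?_⟩
  have h0 := TorsionTorus.eq_zero_of_solvesEquationsOfMotion hα hγ₁ hγ₂ hf hf_pos hτ h
  refine ⟨h0, ?_⟩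
  funext p
  simp [TorsionTorus.torsionForm, h0]
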